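/- Let $q$ be a power of a prime $p$, let $\mathbb{F}_q$ be the finite field with $q$ elements, let $\beta_1,\dots,\beta_{q-1}$ be an enumeration without repetition of $\mathbb{F}_q^*=\mathbb{F}_q\setminus\{0\}$, let $b\in\mathbb{F}_q^*$, and let $$M=\begin{pmatrix}a_{11}&a_{12}\\a_{21}&a_{22}\end{pmatrix}\in\mathrm{GL}_2(\mathbb{F}_q).$$ For an integer $k$, let $\mathrm{EGRL}_{k,2,0}(\mathbb{F}_q^*,\mathbf 1,b)\subseteq\mathbb{F}_q^{q+2}$ be the linear code of all words $$\bigl(f(\beta_1),\dots,f(\beta_{q-1}),\;a_{11}f_{k-2}+a_{21}f_{k-1},\;a_{12}f_{k-2}+a_{22}f_{k-1},\;bf_0\bigr),$$ where $f(x)=\sum_{i=0}^{k-1}f_ix^i$ runs over the polynomials over $\mathbb{F}_q$ of degree less than $k$. Let $C$ be its Euclidean dual, $C=\mathrm{EGRL}_{k,2,0}^{\perp}(\mathbb{F}_q^*,\mathbf 1,b)$. An $[n,K,d]$ code is a linear code of length $n$, dimension $K$ and minimum distance $d$ (the least Hamming weight of a nonzero codeword); it is called AMDS if $d=n-K$.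 Assume that either $p=2$ and $5\le k\le q-2$, or $p\ne 2$ and $4\le k\le q-1$. Then $C$ is AMDS with parameters $[q+2,\,q+2-k,\,k]$. Moreover, put $$\Theta=(-1)^{\lfloor\frac{k-1}{p}\rfloor+1}\binom{\frac qp-1}{\lfloor\frac{k-1}{p}\rfloor}+(-1)^{\lfloor\frac{k-2}{p}\rfloor}\binom{\frac qp-1}{\lfloor\frac{k-2}{p}\rfloor}.$$ Then the number $A_k^{\perp}$ of codewords of Hamming weight $k$ in $C$ is $$A_k^{\perp}=\begin{cases} \frac{2(q-1)}{q}\binom{q}{k-1}+(-1)^{k-1}\frac{2(q-1)}{q}\,\Theta,&\text{if }a_{11}a_{21}a_{12}a_{22}\ne0;\\[4pt] \frac{2(q-1)}{q}\binom{q}{k-1}+(-1)^{k-2}\frac{(q-1)(q-2)}{q}\,\Theta,&\text{if }a_{11}a_{12}a_{21}\ne0\text{ and }a_{22}=0,\text{ or }a_{11}a_{12}a_{22}\ne0\text{ and }a_{21}=0;\\[4pt] \frac{q-1}{q}\binom{q}{k-1}+(-1)^{k-1}\frac{q-1}{q}\,\Theta,&\text{if }a_{11}a_{21}a_{22}\ne0\text{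 and }a_{12}=0,\text{ or }a_{12}a_{21}a_{22}\ne0\text{ and }a_{11}=0;\\[4pt] \frac{q-1}{q}\binom{q}{k-1}+(-1)^{k-2}\frac{(q-1)^2}{q}\,\Theta,&\text{if }a_{11}a_{22}\ne0\text{ and }a_{12}=a_{21}=0,\text{ or }a_{12}a_{21}\ne0\text{ and }a_{11}=a_{22}=0. \end{cases}$$ -/

import Mathlib

open Polynomial

namespace EGRLCode

/-- The encoding map of the extended generalized Roth-Lempel code: the polynomial `f` is sent to
`(v₁ f(α₁), …, vₙ f(αₙ), β, b f_t)` with `β = (f_{k-ℓ}, …, f_{k-1}) M`. The coordinates are indexed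
by the sum type `Fin n ⊕ Fin ℓ ⊕ Fin 1`, which has `n + ℓ + 1` elements. -/
noncomputable def encode {F : Type*} [Field F] {n : ℕ} (k ℓ t : ℕ) (α : Fin n ↪ F)
    (v : Fin n → Fˣ) (M : Matrix.GeneralLinearGroup (Fin ℓ) F) (b : Fˣ) :
    F[X] →ₗ[F] (Fin n ⊕ Fin ℓ ⊕ Fin 1 → F) where
  toFun f := Sum.elim (fun i => (v i : F) * f.eval (α i))
    (Sum.elim
      (Matrix.vecMul (fun i : Fin ℓ => f.coeff (k - ℓ + i)) (M : Matrix (Fin ℓ) (Fin ℓ) F))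
      (fun _ => (b : F) * f.coeff t))
  map_add' f g := by
    ext (i | j | j)
    · simp [mul_add]
    · simp [Matrix.vecMul, dotProduct, add_mul, Finset.sum_add_distrib]
    · simp [mul_add]
  map_smul' c f := by
    ext (i | j | j)
    · simp [mul_left_comm]
    · simp [Matrix.vecMul, dotProduct, mul_assoc, Finset.mul_sum]
    · simp [mul_left_comm]

/-- The extended generalized Roth-Lempel code `EGRL_{k,ℓ,t}(α, v, b)` with matrix `M`: the words
that encode the polynomials of degree less than `k`. -/
noncomputable def EGRL {F : Type*} [Field F] {n : ℕ} (k ℓ t : ℕ) (α : Fin n ↪ F)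
    (v : Fin n → Fˣ) (M : Matrix.GeneralLinearGroup (Fin ℓ) F) (b : Fˣ) :
    Submodule F (Fin n ⊕ Fin ℓ ⊕ Fin 1 → F) :=
  (degreeLT F k).map (encode k ℓ t α v M b)

/-- The Euclidean dual of a linear code. -/
def dualCode {F ι : Type*} [Field F] [Fintype ι] (C : Submodule F (ι → F)) :
    Submodule F (ι → F) where
  carrier := {x | ∀ y ∈ C, ∑ i, x i * y i = 0}
  zero_mem' := by simp
  add_mem' := by
    intro x x' hx hx' y hy
    simp only [Pi.add_apply, add_mul, Finset.sum_add_distrib, hx y hy, hx' y hy, add_zero]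
  smul_mem' := by
    intro c x hx y hy
    simp only [Pi.smul_apply, smul_eq_mul, mul_assoc, ← Finset.mul_sum, hx y hy, mul_zero]

/-- `C` is a linear code with parameters `[N, K, d]`: it has length `N`, dimension `K`, and `d` is
its minimum distance, i.e. the smallest Hamming weight of a nonzero codeword. -/
def HasParams {F ι : Type*} [Field F] [DecidableEq F] [Fintype ι]
    (C : Submodule F (ι → F)) (N K d : ℕ) : Prop :=
  Fintype.card ι = N ∧ Module.finrank F C = K ∧
    IsLeast {w : ℕ | ∃ x ∈ C, x ≠ 0 ∧ hammingNorm x = w} d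

/-- A linear code is almost MDS if it is an `[N, K, d]` code with `d = N - K`. -/
def IsAMDS {F ι : Type*} [Field F] [DecidableEq F] [Fintype ι]
    (C : Submodule F (ι → F)) : Prop :=
  ∃ N K d : ℕ, HasParams C N K d ∧ (d : ℤ) = (N : ℤ) - (K : ℤ)

/-- The number of codewords of Hamming weight `w`. -/
noncomputable def weightCount {F ι : Type*} [Field F] [DecidableEq F] [Fintype ι]
    (C : Submodule F (ι → F)) (w : ℕ) : ℕ :=
  Set.ncard {c : ι → F | c ∈ C ∧ hammingNorm c = w}

/-- The number
`(-1)^{⌊(k-1)/p⌋+1} binom(q/p-1, ⌊(k-1)/p⌋) + (-1)^{⌊(k-2)/p⌋} binom(q/p-1, ⌊(k-2)/p⌋)`.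
It is used only for `2 ≤ k` and `p ∣ q`, `0 < q`, where the natural-number subtractions and the
division `q / p` are exact, and `(k - 1) / p`, `(k - 2) / p` are the floors. -/
def theta (q p k : ℕ) : ℤ :=
  (-1) ^ ((k - 1) / p + 1) * ((q / p - 1).choose ((k - 1) / p) : ℤ) +
    (-1) ^ ((k - 2) / p) * ((q / p - 1).choose ((k - 2) / p) : ℤ)

end EGRLCode

/-! Since `b * f.coeff 0 = b * f(0)`, rescaling one coordinate turns the code into evaluation at all
points of `F` together with two points at infinity, one for each column of `M` (`pull_mem_iff`).

Take a nonzero dual word with finite support `S` and weight at most `k`. If `S` had at most `k - 2`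
points, or if the word vanished at infinity, pairing with Lagrange basis polynomials would kill the
finite part, and invertibility of `M` would kill the rest. So `S` has `k - 1` points, exactly one
infinite coordinate `j` is nonzero, and the weight is `k`. Pairing with the nodal polynomial of `S`
forces `A 0 j * ∑ S = A 1 j`. Conversely, each such pair `(j, S)` carries a one-dimensional space of
dual words. Hence the count is `q - 1` times a number of `(k-1)`-subsets of `F` with prescribed sum
(`ncard_weight`).

By scaling, the number of `m`-subsets with sum `c` depends only on whether `c = 0`. A nontrivial
additive character gives the difference of the two values as a coefficient of `(X ^ p - 1) ^ (q /
p)`, which Pascal's rule rewrites as `theta`. That the distance `k` is attained is shown by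
constructing a subset directly. -/

namespace EGRLCode

/-! ### Counting subsets with prescribed sum by characters -/

/-- The product of `X - ψ a` over a finite field of characteristic `p`. -/
lemma prod_X_sub_addChar {F : Type*} [Field F] [Fintype F] {p : ℕ} [CharP F p]
    (hp : p.Prime) {ψ : AddChar F ℂ} (hψ : ψ ≠ 1) :
    ∏ a : F, (X - C (ψ a)) = (X ^ p - 1 : ℂ[X]) ^ (Fintype.card F / p) := by
  have hpow (a : F) : ψ a ^ p = 1 := by
    rw [← AddChar.map_nsmul_eq_pow]; simp
  obtain ⟨a₀, ha₀⟩ : ∃ a, ψ a ≠ 1 := by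
    by_contra! h
    exact hψ (by ext a; simp [h a])
  have hprim : IsPrimitiveRoot (ψ a₀) p := by
    have := orderOf_eq_prime (hpow a₀) (hp := ⟨hp⟩) ha₀
    rw [← this]; exact IsPrimitiveRoot.orderOf _
  have : NeZero p := ⟨hp.ne_zero⟩
  have hmem (a : F) : ψ a ∈ nthRootsFinset p (1 : ℂ) := by
    rw [mem_nthRootsFinset hp.pos]; exact hpow a
  -- Every fibre of `ψ` over a `p`-th root of unity is a translate of the kernel, so each root
  -- occurs `q / p` times.
  have hfib (ζ : ℂ) (hζ : ζ ∈ nthRootsFinset p (1 : ℂ)) :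
      (Finset.univ.filter fun a => ψ a = ζ).card = (Finset.univ.filter fun a => ψ a = 1).card := by
    obtain ⟨i, -, hi⟩ := hprim.eq_pow_of_pow_eq_one ((mem_nthRootsFinset hp.pos _).1 hζ)
    have hi' : ψ (i • a₀) = ζ := by rw [AddChar.map_nsmul_eq_pow, hi]
    have hζ0 : ζ ≠ 0 := by rw [← hi']; exact (ψ.val_isUnit _).ne_zero
    symm
    refine Finset.card_bij (fun a _ => a + i • a₀) ?_ (by simp) ?_
    · intro a ha
      simp only [Finset.mem_filter, Finset.mem_univ, true_and] at ha ⊢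
      rw [AddChar.map_add_eq_mul, ha, hi', one_mul]
    · intro a ha
      simp only [Finset.mem_filter, Finset.mem_univ, true_and] at ha
      refine ⟨a - i • a₀, ?_, by simp⟩
      simp only [Finset.mem_filter, Finset.mem_univ, true_and]
      have := ψ.map_add_eq_mul (a - i • a₀) (i • a₀)
      rw [sub_add_cancel, ha, hi'] at this
      exact (mul_right_cancel₀ hζ0 (by rw [one_mul]; exact this)).symm
  have hcard : Fintype.card F = p * (Finset.univ.filter fun a => ψ a = 1).card := by
    rw [← Finset.card_univ, Finset.card_eq_sum_card_fiberwise (f := ψ)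
      (t := nthRootsFinset p (1 : ℂ)) (fun a _ => hmem a), Finset.sum_congr rfl hfib]
    simp [hprim.card_nthRootsFinset]
  rw [hcard, Nat.mul_div_cancel_left _ hp.pos, X_pow_sub_one_eq_prod hp.pos hprim,
    ← Finset.prod_pow, ← Finset.prod_fiberwise_of_maps_to (fun a _ => hmem a)]
  refine Finset.prod_congr rfl fun ζ hζ => ?_
  rw [Finset.prod_congr rfl (g := fun _ => X - C ζ)
    (fun a ha => by rw [(Finset.mem_filter.1 ha).2]), Finset.prod_const, hfib ζ hζ]

/-- The number of `m`-element subsets of `F` whose elements sum to `c`. -/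
def subsetSumCount (F : Type*) [Field F] [Fintype F] [DecidableEq F] (m : ℕ) (c : F) : ℕ :=
  (((Finset.univ : Finset F).powersetCard m).filter fun S => ∑ x ∈ S, x = c).card

section SubsetSums

variable {F : Type*} [Field F] [Fintype F] [DecidableEq F]

/-- Multiplication by `d` maps `m`-subsets injectively to `m`-subsets and scales their sums. -/
lemma subsetSumCount_le_mul (m : ℕ) (c : F) {d : F} (hd : d ≠ 0) :
    subsetSumCount F m c ≤ subsetSumCount F m (d * c) := by
  refine Finset.card_le_card_of_injOn (fun S => S.map ⟨(d * ·), mul_right_injective₀ hd⟩) ?_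
    ((Finset.map_injective _).injOn)
  intro S hS
  simp only [Finset.coe_filter, Finset.mem_powersetCard_univ, Set.mem_ofPred_eq] at hS ⊢
  refine ⟨by simpa using hS.1, ?_⟩
  rw [Finset.sum_map, ← hS.2, Finset.mul_sum]
  rfl

lemma subsetSumCount_eq_one (m : ℕ) {c : F} (hc : c ≠ 0) :
    subsetSumCount F m c = subsetSumCount F m 1 := by
  apply le_antisymm
  · simpa [hc] using subsetSumCount_le_mul m c (inv_ne_zero hc)
  · simpa using subsetSumCount_le_mul m (1 : F) hc

lemma sum_subsetSumCount_mul {R : Type*} [CommRing R] (m : ℕ) (g : F → R) :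
    ∑ c, (subsetSumCount F m c : R) * g c =
      ∑ S ∈ (Finset.univ : Finset F).powersetCard m, g (∑ x ∈ S, x) := by
  rw [← Finset.sum_fiberwise_of_maps_to (t := Finset.univ) (g := fun S : Finset F => ∑ x ∈ S, x)
    (fun _ _ => Finset.mem_univ _)]
  refine Finset.sum_congr rfl fun c _ => ?_
  rw [Finset.sum_congr rfl (g := fun _ => g c) (fun S hS => by rw [(Finset.mem_filter.1 hS).2])]
  simp [subsetSumCount]

/-- The count is constant off `0`. Taking `g = 1` gives the total; taking `g` a nontrivial character
removes the last sum and isolates the difference. -/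
lemma sum_subsetSumCount_mul_eq {R : Type*} [CommRing R] (m : ℕ) (g : F → R) :
    ∑ c, (subsetSumCount F m c : R) * g c =
      (subsetSumCount F m (0 : F) - subsetSumCount F m (1 : F)) * g 0 +
        subsetSumCount F m (1 : F) * ∑ c, g c := by
  rw [← Finset.add_sum_erase _ _ (Finset.mem_univ (0 : F)),
    ← Finset.add_sum_erase _ g (Finset.mem_univ (0 : F)),
    Finset.sum_congr rfl (g := fun c => (subsetSumCount F m (1 : F) : R) * g c)
      (fun c hc => by rw [subsetSumCount_eq_one m (Finset.ne_of_mem_erase hc)]), ← Finset.mul_sum]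
  ring

lemma subsetSumCount_total (m : ℕ) :
    (subsetSumCount F m (0 : F) - subsetSumCount F m (1 : F) : ℤ) +
      subsetSumCount F m (1 : F) * Fintype.card F = (Fintype.card F).choose m := by
  have h := sum_subsetSumCount_mul_eq (R := ℤ) m (fun _ : F => 1)
  rw [sum_subsetSumCount_mul] at h
  simp [Finset.card_univ] at h
  linarith

/-- Summing `ψ (∑ S)` over `m`-subsets gives the `m`-th elementary symmetric function of the values
of `ψ`, which Vieta reads off from `∏ (X - ψ a)`. -/
lemma subsetSumCount_zero_sub_one {p : ℕ} [CharP F p] (hp : p.Prime) {m : ℕ}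
    (hm : m ≤ Fintype.card F) :
    (subsetSumCount F m (0 : F) - subsetSumCount F m (1 : F) : ℂ) =
      (-1) ^ m * ((X ^ p - 1 : ℂ[X]) ^ (Fintype.card F / p)).coeff (Fintype.card F - m) := by
  obtain ⟨ψ, hψ₁⟩ := AddChar.exists_apply_ne_zero.2 (one_ne_zero (α := F))
  have hψ : ψ ≠ 1 := by rintro rfl; simp at hψ₁
  have h := sum_subsetSumCount_mul_eq m ψ
  rw [AddChar.sum_eq_zero_of_ne_one hψ, sum_subsetSumCount_mul, mul_zero, add_zero,
    AddChar.map_zero_eq_one, mul_one] at h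
  rw [← h, ← prod_X_sub_addChar hp hψ]
  have h2 := Finset.prod_X_add_C_coeff (Finset.univ : Finset F) (fun a => -ψ a)
    (k := Fintype.card F - m) (by simp)
  simp only [C_neg, ← sub_eq_add_neg, Finset.card_univ, Nat.sub_sub_self hm] at h2
  rw [h2, Finset.mul_sum]
  refine Finset.sum_congr rfl fun S hS => ?_
  rw [Finset.prod_neg, (Finset.mem_powersetCard.1 hS).2, ← mul_assoc, ← mul_pow]
  simp only [neg_mul_neg, one_mul, one_pow]
  exact map_prod ψ.toMonoidHom (fun x => Multiplicative.ofAdd x) S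

/-- If `p ∤ m` the coefficient is zero, and the two floors in `theta` agree, so its terms cancel. If
`m = p * t` the floors are `t` and `t - 1`, and Pascal's rule merges the terms into one binomial. -/
lemma coeff_X_pow_sub_one_pow {R : Type*} [CommRing R] {p n m : ℕ} (hp : 0 < p) (hm : 0 < m)
    (hmn : m ≤ p * n) :
    ((X ^ p - 1 : R[X]) ^ n).coeff (p * n - m) = -(theta (p * n) p (m + 1) : R) := by
  have hexp : (X ^ p - 1 : R[X]) ^ n = expand R p ((X + C (-1)) ^ n) := by simp [sub_eq_add_neg]
  rw [hexp, coeff_expand hp, theta, Nat.mul_div_cancel_left _ hp, Nat.add_sub_cancel,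
    show m + 1 - 2 = m - 1 by omega]
  by_cases hd : p ∣ m
  · obtain ⟨t, rfl⟩ := hd
    have ht : 0 < t := Nat.pos_of_ne_zero (by rintro rfl; simp at hm)
    have htn : t ≤ n := Nat.le_of_mul_le_mul_left hmn hp
    obtain ⟨s, rfl⟩ : ∃ s, t = s + 1 := ⟨t - 1, by omega⟩
    obtain ⟨r, rfl⟩ : ∃ r, n = r + 1 := ⟨n - 1, by omega⟩
    have h1 : (p * (s + 1) - 1) / p = s := by
      rw [Nat.div_eq_iff hp]
      constructor
      · rw [mul_comm p, Nat.succ_mul]; omega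
      · rw [mul_comm p, Nat.succ_mul]
    rw [← Nat.mul_sub, if_pos (dvd_mul_right _ _), Nat.mul_div_cancel_left _ hp,
      Nat.mul_div_cancel_left _ hp, h1, coeff_X_add_C_pow, Nat.sub_sub_self htn,
      Nat.choose_symm htn, Nat.add_sub_cancel, Nat.choose_succ_succ]
    push_cast
    ring
  · have h1 : (m - 1) / p = m / p := by
      obtain ⟨u, rfl⟩ : ∃ u, m = u + 1 := ⟨m - 1, by omega⟩
      rw [Nat.succ_div, if_neg hd]; simp
    rw [if_neg, h1]
    · push_cast; ring
    · intro h
      have := Nat.dvd_sub (dvd_mul_right p n) h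
      rw [Nat.sub_sub_self hmn] at this
      exact hd this

lemma subsetSumCount_zero_sub_one_eq_theta {p : ℕ} [CharP F p] (hp : p.Prime) {m : ℕ}
    (hm : 0 < m) (hmq : m ≤ Fintype.card F) :
    (subsetSumCount F m (0 : F) - subsetSumCount F m (1 : F) : ℤ) =
      -((-1) ^ m * theta (Fintype.card F) p (m + 1)) := by
  obtain ⟨n, hn⟩ : p ∣ Fintype.card F := by
    rw [← CharP.cast_eq_zero_iff F p]; exact Nat.cast_card_eq_zero F
  have h := subsetSumCount_zero_sub_one (F := F) hp hmq
  have h2 := coeff_X_pow_sub_one_pow (R := ℂ) (n := n) hp.pos hm (hn ▸ hmq)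
  rw [show Fintype.card F / p = n by rw [hn, Nat.mul_div_cancel_left _ hp.pos]] at h
  rw [← hn] at h2
  rw [h2] at h
  have h3 : ((subsetSumCount F m (0 : F) - subsetSumCount F m (1 : F) : ℤ) : ℂ) =
      ((-((-1) ^ m * theta (Fintype.card F) p (m + 1)) : ℤ) : ℂ) := by
    push_cast
    rw [h]; ring
  exact_mod_cast h3

/-- The number of `m`-subsets of a finite field with prescribed nonzero sum. -/
theorem subsetSumCount_of_ne_zero {p : ℕ} [CharP F p] (hp : p.Prime) {m : ℕ}
    (hm : 0 < m) (hmq : m ≤ Fintype.card F) {c : F} (hc : c ≠ 0) :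
    (subsetSumCount F m c : ℚ) = ((Fintype.card F).choose m +
      (-1) ^ m * theta (Fintype.card F) p (m + 1)) / Fintype.card F := by
  have h1 := congrArg (Int.cast (R := ℚ)) (subsetSumCount_zero_sub_one_eq_theta (F := F) hp hm hmq)
  have h2 := congrArg (Int.cast (R := ℚ)) (subsetSumCount_total (F := F) m)
  have hq : (Fintype.card F : ℚ) ≠ 0 := by exact_mod_cast Fintype.card_ne_zero
  rw [subsetSumCount_eq_one m hc, eq_div_iff hq]
  push_cast at h1 h2
  linarith

/-- The number of `m`-subsets of a finite field with sum zero. -/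
theorem subsetSumCount_zero {p : ℕ} [CharP F p] (hp : p.Prime) {m : ℕ}
    (hm : 0 < m) (hmq : m ≤ Fintype.card F) :
    (subsetSumCount F m (0 : F) : ℚ) = ((Fintype.card F).choose m -
      (-1) ^ m * (Fintype.card F - 1) * theta (Fintype.card F) p (m + 1)) / Fintype.card F := by
  have h1 := congrArg (Int.cast (R := ℚ)) (subsetSumCount_zero_sub_one_eq_theta (F := F) hp hm hmq)
  have h2 := subsetSumCount_of_ne_zero (F := F) hp hm hmq one_ne_zero
  have hq : (Fintype.card F : ℚ) ≠ 0 := by exact_mod_cast Fintype.card_ne_zero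
  push_cast at h1
  rw [h2] at h1
  rw [eq_div_iff hq]
  field_simp at h1
  linarith

/-! ### Existence of subsets with prescribed sum -/

/-- Two `m`-sets that differ in exactly one element have different sums, so one of them avoids `c`.
-/
lemma exists_finset_card_sum_ne {m : ℕ} (hm : 0 < m) (hmq : m < Fintype.card F) (c : F) :
    ∃ T : Finset F, T.card = m ∧ ∑ x ∈ T, x ≠ c := by
  obtain ⟨T, -, hT⟩ := Finset.exists_subset_card_eq
    (show m - 1 ≤ (Finset.univ : Finset F).card by rw [Finset.card_univ]; omega)
  have h2 : 1 < (Tᶜ).card := by rw [Finset.card_compl]; omega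
  obtain ⟨x, hx, y, hy, hxy⟩ := Finset.one_lt_card.1 h2
  rw [Finset.mem_compl] at hx hy
  by_cases hs : ∑ z ∈ insert x T, z = c
  · refine ⟨insert y T, by rw [Finset.card_insert_of_notMem hy]; omega, fun h => hxy ?_⟩
    rw [← hs, Finset.sum_insert hx, Finset.sum_insert hy] at h
    exact (add_right_cancel h).symm
  · exact ⟨insert x T, by rw [Finset.card_insert_of_notMem hx]; omega, hs⟩

/-- Fix `m - 2` elements `T` and complete them by a pair `x`, `d - x`. The bad `x` lie in `T`, in `d
- T`, or satisfy `x + x = d`: at most `2 * (m - 2) + 1 < q` of them. In characteristic two `T` must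
be chosen with `d ≠ 0`, since otherwise every `x` is bad. -/
lemma exists_finset_card_sum_eq_of_le {p : ℕ} [CharP F p] {m : ℕ} (hm : 2 ≤ m)
    (hm2 : p = 2 → 3 ≤ m) (hmq : 2 * m ≤ Fintype.card F) (c : F) :
    ∃ S : Finset F, S.card = m ∧ ∑ x ∈ S, x = c := by
  obtain ⟨T, hT, hTc⟩ : ∃ T : Finset F, T.card = m - 2 ∧ (p = 2 → ∑ x ∈ T, x ≠ c) := by
    by_cases h2 : p = 2
    · obtain ⟨T, h, h'⟩ := exists_finset_card_sum_ne (F := F) (m := m - 2)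
        (by have := hm2 h2; omega) (by omega) c
      exact ⟨T, h, fun _ => h'⟩
    · obtain ⟨T, -, hT⟩ := Finset.exists_subset_card_eq
        (show m - 2 ≤ (Finset.univ : Finset F).card by rw [Finset.card_univ]; omega)
      exact ⟨T, hT, fun h => absurd h h2⟩
  set d := c - ∑ x ∈ T, x with hd
  have hdbl : (Finset.univ.filter fun x : F => x + x = d).card ≤ 1 := by
    rw [Finset.card_le_one]
    intro x hx y hy
    simp only [Finset.mem_filter, Finset.mem_univ, true_and] at hx hy
    rw [← two_mul] at hx hy
    have h0 : (2 : F) ≠ 0 := by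
      intro h0
      rw [h0, zero_mul] at hx
      have h2 : p ∣ 2 := (CharP.cast_eq_zero_iff F p 2).1 (by exact_mod_cast h0)
      have hp2 : p = 2 := ((Nat.prime_dvd_prime_iff_eq
        (CharP.char_is_prime F p) Nat.prime_two).1 h2)
      exact hTc hp2 (by rw [hd] at hx; exact (sub_eq_zero.1 hx.symm).symm)
    exact mul_left_cancel₀ h0 (hx.trans hy.symm)
  have hcard : (T ∪ T.image (d - ·) ∪ Finset.univ.filter fun x : F => x + x = d).card <
      (Finset.univ : Finset F).card := by
    have h1 := Finset.card_union_le (T ∪ T.image (d - ·)) (Finset.univ.filter fun x : F => x + x = d)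
    have h2 := Finset.card_union_le T (T.image (d - ·))
    have h3 := Finset.card_image_le (s := T) (f := (d - ·))
    rw [Finset.card_univ]
    omega
  obtain ⟨x, -, hx⟩ := Finset.exists_mem_notMem_of_card_lt_card hcard
  simp only [Finset.mem_union, Finset.mem_image, Finset.mem_filter, Finset.mem_univ, true_and,
    not_or, not_exists, not_and] at hx
  obtain ⟨⟨hx1, hx2⟩, hx3⟩ := hx
  have hy1 : d - x ∉ T := fun h => hx2 _ h (by ring)
  have hy2 : d - x ∉ insert x T := by
    rw [Finset.mem_insert, not_or]
    exact ⟨fun h => hx3 (by linear_combination -h), hy1⟩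
  refine ⟨insert (d - x) (insert x T), ?_, ?_⟩
  · rw [Finset.card_insert_of_notMem hy2, Finset.card_insert_of_notMem hx1]; omega
  · rw [Finset.sum_insert hy2, Finset.sum_insert hx1, hd]; ring

/-- Every element of a finite field is a sum of `m` distinct elements, as soon as `m` and its
complement are at least `2`, and at least `3` in characteristic two. -/
theorem exists_finset_card_sum_eq {p : ℕ} [CharP F p] {m : ℕ} (hm : 2 ≤ m) (hm2 : p = 2 → 3 ≤ m)
    (hmq : m + 2 ≤ Fintype.card F) (hmq2 : p = 2 → m + 3 ≤ Fintype.card F) (c : F) :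
    ∃ S : Finset F, S.card = m ∧ ∑ x ∈ S, x = c := by
  by_cases h : 2 * m ≤ Fintype.card F
  · exact exists_finset_card_sum_eq_of_le hm hm2 h c
  -- For large `m`, pass to the complement, whose sum is the sum over `F` minus `c`.
  · obtain ⟨S, hS, hsum⟩ := exists_finset_card_sum_eq_of_le (F := F) (p := p)
      (m := Fintype.card F - m) (by omega) (fun h => by have := hmq2 h; omega) (by omega)
      (∑ x, x - c)
    refine ⟨Sᶜ, by rw [Finset.card_compl]; omega, ?_⟩
    have := Finset.sum_add_sum_compl S (fun x => x)
    rw [hsum] at this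
    linear_combination this

end SubsetSums

end EGRLCode

namespace EGRLCode

/-! ### Minimum weight words of the dual on all of `F` and two points at infinity -/

section FullCode

lemma coeff_nodal_sub_one {F : Type*} [Field F] (S : Finset F) (hS : 0 < S.card) :
    (Lagrange.nodal S id).coeff (S.card - 1) = -∑ a ∈ S, a := by
  rw [Lagrange.nodal_eq]
  simpa using Polynomial.prod_X_sub_C_coeff_card_pred S (id : F → F) hS

/-- Evaluation at the points of a set as a linear functional on polynomials of degree at most its
cardinality. -/
lemma sum_eval_div_prod {F : Type*} [Field F] [DecidableEq F] {S : Finset F} (hS : 0 < S.card) {f : F[X]}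
    (hf : f ∈ degreeLT F (S.card + 1)) :
    ∑ a ∈ S, f.eval a / ∏ b ∈ S.erase a, (a - b) =
      f.coeff (S.card - 1) + f.coeff S.card * ∑ a ∈ S, a := by
  -- Removing the top term with the nodal polynomial leaves the values on `S` unchanged and makes
  -- the degree small enough for the Lagrange leading coefficient formula.
  set r := f - C (f.coeff S.card) * Lagrange.nodal S id with hr
  have hmon : (Lagrange.nodal S (id : F → F)).coeff S.card = 1 := by
    have h := (Lagrange.nodal_monic (s := S) (v := (id : F → F))).coeff_natDegree
    rwa [Lagrange.natDegree_nodal] at h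
  have hrdeg : r.degree < S.card := by
    rw [degree_lt_iff_coeff_zero]
    intro m hm
    rcases hm.eq_or_lt with rfl | hm
    · rw [hr, coeff_sub, coeff_C_mul, hmon, mul_one, sub_self]
    · rw [mem_degreeLT, degree_lt_iff_coeff_zero] at hf
      rw [hr, coeff_sub, coeff_C_mul, hf m hm,
        coeff_eq_zero_of_natDegree_lt (p := Lagrange.nodal S id)
          (by rwa [Lagrange.natDegree_nodal]), mul_zero, sub_zero]
  have h := Lagrange.coeff_eq_sum (Function.injective_id.injOn : Set.InjOn (id : F → F) S) hrdeg
  rw [hr, coeff_sub, coeff_C_mul, coeff_nodal_sub_one S hS] at h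
  have hsum : ∑ a ∈ S, eval (id a) r / ∏ b ∈ S.erase a, (id a - id b) =
      ∑ a ∈ S, f.eval a / ∏ b ∈ S.erase a, (a - b) := by
    refine Finset.sum_congr rfl fun a ha => ?_
    rw [hr, eval_sub, eval_mul, Lagrange.eval_nodal_at_node ha]
    simp
  rw [← hsum, ← h]
  ring

/-- If the top entry vanished, the whole column would, against `det ≠ 0`. -/
lemma col_ne_zero {F : Type*} [Field F] {A : Matrix (Fin 2) (Fin 2) F} (hA : A.det ≠ 0) {j : Fin 2} {s : F}
    (h : A 0 j * s = A 1 j) : A 0 j ≠ 0 := by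
  intro h0
  rw [h0, zero_mul] at h
  apply hA
  rw [Matrix.det_fin_two]
  obtain rfl | rfl : j = 0 ∨ j = 1 := by omega
  · linear_combination A 1 1 * h0 + A 0 1 * h
  · linear_combination -A 0 0 * h - A 1 0 * h0

/-- The word with value `c` at the point `j` at infinity and finite support `S`. -/
def minWord {F : Type*} [Field F] [DecidableEq F] (A : Matrix (Fin 2) (Fin 2) F) (j : Fin 2) (S : Finset F) (c : F) : F ⊕ Fin 2 → F :=
  Sum.elim (fun a => if a ∈ S then -(c * A 0 j) / ∏ b ∈ S.erase a, (a - b) else 0)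
    (Pi.single j c)

lemma infSupp_minWord {F : Type*} [Field F] [DecidableEq F] (A : Matrix (Fin 2) (Fin 2) F) (j : Fin 2) (S : Finset F)
    {c : F} (hc : c ≠ 0) :
    (Finset.univ.filter fun i => minWord A j S c (.inr i) ≠ 0) = {j} := by
  ext i
  rw [Finset.mem_filter, Finset.mem_singleton]
  by_cases h : i = j
  · subst h; simp [minWord, hc]
  · simp [minWord, h]

variable {F : Type*} [Field F] [Fintype F]

/-- The pairing of a word indexed by the points of `F` and two points at infinity with a
polynomial. -/
noncomputable def pairing (k : ℕ) (A : Matrix (Fin 2) (Fin 2) F) (x : F ⊕ Fin 2 → F) (f : F[X]) :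
    F :=
  ∑ a, x (.inl a) * f.eval a +
    ∑ j, x (.inr j) * (f.coeff (k - 2) * A 0 j + f.coeff (k - 1) * A 1 j)

/-- The words on `F` and two points at infinity that are orthogonal to all polynomials of degree
less than `k`. -/
noncomputable def fullDual (k : ℕ) (A : Matrix (Fin 2) (Fin 2) F) :
    Submodule F (F ⊕ Fin 2 → F) where
  carrier := {x | ∀ f ∈ degreeLT F k, pairing k A x f = 0}
  zero_mem' := by simp [pairing]
  add_mem' := by
    intro x y hx hy f hf
    have h1 := hx f hf
    have h2 := hy f hf
    simp only [pairing, Pi.add_apply, add_mul, Finset.sum_add_distrib] at h1 h2 ⊢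
    linear_combination h1 + h2
  smul_mem' := by
    intro c x hx f hf
    have h1 := hx f hf
    simp only [pairing, Pi.smul_apply, smul_eq_mul, mul_assoc, ← Finset.mul_sum] at h1 ⊢
    linear_combination c * h1

lemma pairing_X_pow_of_inl {k i : ℕ} {A : Matrix (Fin 2) (Fin 2) F} {x : F ⊕ Fin 2 → F}
    (hx : x ∈ fullDual k A) (h0 : ∀ a, x (.inl a) = 0) (hi : i < k) :
    ∑ j, x (.inr j) * ((X ^ i : F[X]).coeff (k - 2) * A 0 j + (X ^ i : F[X]).coeff (k - 1) * A 1 j)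
      = 0 := by
  have h := hx (X ^ i) (by rw [mem_degreeLT, degree_X_pow]; exact_mod_cast hi)
  simpa [pairing, h0] using h

/-- Pairing with `X ^ (k - 2)` and `X ^ (k - 1)` gives the two rows of a linear system with
invertible matrix `A`. -/
lemma eq_zero_of_inl_eq_zero {k : ℕ} (hk : 2 ≤ k) {A : Matrix (Fin 2) (Fin 2) F} (hA : A.det ≠ 0)
    {x : F ⊕ Fin 2 → F} (hx : x ∈ fullDual k A) (h0 : ∀ a, x (.inl a) = 0) : x = 0 := by
  have h1 := pairing_X_pow_of_inl hx h0 (i := k - 2) (by omega)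
  have h2 := pairing_X_pow_of_inl hx h0 (i := k - 1) (by omega)
  simp only [coeff_X_pow, if_true, if_neg (show k - 1 ≠ k - 2 by omega),
    if_neg (show k - 2 ≠ k - 1 by omega), one_mul, zero_mul, add_zero, zero_add] at h1 h2
  have h3 : A.mulVec (fun j => x (.inr j)) = 0 := by
    ext i
    fin_cases i
    · simpa [Matrix.mulVec, dotProduct, mul_comm] using h1
    · simpa [Matrix.mulVec, dotProduct, mul_comm] using h2
  have h4 := Matrix.eq_zero_of_mulVec_eq_zero hA h3
  ext (a | j)
  · exact h0 a
  · exact congrFun h4 j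

variable [DecidableEq F]

/-- The finite points where a word does not vanish. -/
def finSupp (x : F ⊕ Fin 2 → F) : Finset F := Finset.univ.filter fun a => x (.inl a) ≠ 0

lemma hammingNorm_eq (x : F ⊕ Fin 2 → F) :
    hammingNorm x = (finSupp x).card + (Finset.univ.filter fun j => x (.inr j) ≠ 0).card := by
  simp only [hammingNorm, finSupp, Finset.card_filter, Fintype.sum_sum_type]

lemma mem_finSupp {x : F ⊕ Fin 2 → F} {a : F} : a ∈ finSupp x ↔ x (.inl a) ≠ 0 := by
  simp [finSupp]

lemma sum_finSupp (x : F ⊕ Fin 2 → F) (f : F[X]) {S : Finset F} (hS : finSupp x ⊆ S) :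
    ∑ a, x (.inl a) * f.eval a = ∑ a ∈ S, x (.inl a) * f.eval a := by
  symm
  refine Finset.sum_subset (Finset.subset_univ _) fun a _ ha => ?_
  rw [not_not.1 (fun h => ha (hS (mem_finSupp.2 h))), zero_mul]

/-- If the points at infinity do not contribute to the pairing with the interpolation polynomials
of a set that contains the finite support, then the finite part of the word is zero. -/
lemma inl_eq_zero_of_pairing {k : ℕ} {A : Matrix (Fin 2) (Fin 2) F} {x : F ⊕ Fin 2 → F}
    (hx : x ∈ fullDual k A) {S : Finset F} (hS : finSupp x ⊆ S) (hk : S.card ≤ k)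
    (h : S.card + 2 ≤ k ∨ ∀ j, x (.inr j) = 0) (a : F) : x (.inl a) = 0 := by
  by_contra ha
  have haS : a ∈ S := hS (mem_finSupp.2 ha)
  have hpos : 0 < S.card := Finset.card_pos.2 ⟨a, haS⟩
  have hinj : Set.InjOn (id : F → F) S := Function.injective_id.injOn
  -- Pairing with this polynomial isolates `x (.inl a)`; when `S.card + 2 ≤ k` its degree is below
  -- `k - 2`, so it is invisible at infinity.
  have hdeg : (Lagrange.basis S id a).natDegree = S.card - 1 := Lagrange.natDegree_basis hinj haS
  have hmem : Lagrange.basis S id a ∈ degreeLT F k := by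
    rw [mem_degreeLT]
    refine lt_of_le_of_lt degree_le_natDegree ?_
    rw [hdeg]
    exact_mod_cast (by omega : S.card - 1 < k)
  have h1 := hx _ hmem
  rw [pairing, sum_finSupp x _ hS, Finset.sum_eq_single a] at h1
  · rw [show eval a (Lagrange.basis S id a) = 1 from Lagrange.eval_basis_self hinj haS,
      mul_one, Finset.sum_eq_zero, add_zero] at h1
    · exact ha h1
    · intro j _
      rcases h with h | h
      · rw [coeff_eq_zero_of_natDegree_lt (by omega), coeff_eq_zero_of_natDegree_lt (by omega)]
        simp
      · rw [h j, zero_mul]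
  · intro c hc hca
    rw [show eval c (Lagrange.basis S id a) = 0 from Lagrange.eval_basis_of_ne (v := id) hca.symm hc,
      mul_zero]
  · exact fun h => absurd haS h

/-- The shape of the nonzero words of low weight. -/
lemma low_weight {k : ℕ} (hk : 2 ≤ k) {A : Matrix (Fin 2) (Fin 2) F} (hA : A.det ≠ 0)
    {x : F ⊕ Fin 2 → F} (hx : x ∈ fullDual k A) (hx0 : x ≠ 0) (hw : hammingNorm x ≤ k) :
    (finSupp x).card = k - 1 ∧ (Finset.univ.filter fun j => x (.inr j) ≠ 0).card = 1 := by
  rw [hammingNorm_eq] at hw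
  have h1 : k < (finSupp x).card + 2 := by
    by_contra! h
    exact hx0 (eq_zero_of_inl_eq_zero hk hA hx
      (inl_eq_zero_of_pairing hx subset_rfl (by omega) (.inl h)))
  have h2 : 0 < (Finset.univ.filter fun j => x (.inr j) ≠ 0).card := by
    by_contra! h
    rw [Nat.le_zero, Finset.card_eq_zero, Finset.filter_eq_empty_iff] at h
    exact hx0 (eq_zero_of_inl_eq_zero hk hA hx
      (inl_eq_zero_of_pairing hx subset_rfl (by omega)
        (.inr fun j => not_not.1 (h (Finset.mem_univ j)))))
  -- At least `k - 1` finite and at least one infinite coordinate, with total at most `k`, leave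
  -- only equality.
  omega

lemma le_hammingNorm {k : ℕ} (hk : 2 ≤ k) {A : Matrix (Fin 2) (Fin 2) F} (hA : A.det ≠ 0)
    {x : F ⊕ Fin 2 → F} (hx : x ∈ fullDual k A) (hx0 : x ≠ 0) : k ≤ hammingNorm x := by
  by_contra! h
  have := low_weight hk hA hx hx0 h.le
  rw [hammingNorm_eq] at h
  omega

/-- By `sum_eval_div_prod` the finite part contributes `-c * A 0 j * (f_{k-2} + f_{k-1} * ∑ S)`,
which the sum condition makes opposite to the contribution of `j`. -/
lemma minWord_mem {k : ℕ} (hk : 2 ≤ k) {A : Matrix (Fin 2) (Fin 2) F} {j : Fin 2} {S : Finset F}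
    (hS : S.card = k - 1) (hsum : A 0 j * ∑ a ∈ S, a = A 1 j) (c : F) :
    minWord A j S c ∈ fullDual k A := by
  intro f hf
  have h := sum_eval_div_prod (S := S) (by omega) (f := f) (by rwa [hS, Nat.sub_add_cancel (by omega)])
  rw [hS, Nat.sub_sub] at h
  have h1 : ∑ a, minWord A j S c (.inl a) * f.eval a =
      -(c * A 0 j) * ∑ a ∈ S, f.eval a / ∏ b ∈ S.erase a, (a - b) := by
    rw [Finset.mul_sum, ← Finset.sum_subset (Finset.subset_univ S)]
    · refine Finset.sum_congr rfl fun a ha => ?_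
      simp only [minWord, Sum.elim_inl, if_pos ha]
      ring
    · intro a _ ha
      simp [minWord, ha]
  rw [pairing, h1, h, Finset.sum_eq_single j]
  · simp only [minWord, Sum.elim_inr, Pi.single_eq_same]
    linear_combination -c * f.coeff (k - 1) * hsum
  · intro i _ hij
    simp [minWord, hij]
  · simp

lemma finSupp_minWord {A : Matrix (Fin 2) (Fin 2) F} {j : Fin 2} (hj : A 0 j ≠ 0) (S : Finset F)
    {c : F} (hc : c ≠ 0) : finSupp (minWord A j S c) = S := by
  ext a
  rw [mem_finSupp]
  by_cases ha : a ∈ S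
  · have : ∏ b ∈ S.erase a, (a - b) ≠ 0 :=
      Finset.prod_ne_zero_iff.2 fun b hb => sub_ne_zero.2 (Finset.ne_of_mem_erase hb).symm
    simp [minWord, ha, hj, hc, this]
  · simp [minWord, ha]

lemma hammingNorm_minWord {A : Matrix (Fin 2) (Fin 2) F} {j : Fin 2} (hj : A 0 j ≠ 0)
    (S : Finset F) {c : F} (hc : c ≠ 0) : hammingNorm (minWord A j S c) = S.card + 1 := by
  rw [hammingNorm_eq, finSupp_minWord hj S hc, infSupp_minWord A j S hc, Finset.card_singleton]

lemma exists_eq_minWord {k : ℕ} (hk : 2 ≤ k) {A : Matrix (Fin 2) (Fin 2) F} (hA : A.det ≠ 0)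
    {x : F ⊕ Fin 2 → F} (hx : x ∈ fullDual k A) (hw : hammingNorm x = k) :
    ∃ j S c, c ≠ 0 ∧ S.card = k - 1 ∧ A 0 j * ∑ a ∈ S, a = A 1 j ∧ x = minWord A j S c := by
  have hx0 : x ≠ 0 := by
    rintro rfl
    rw [hammingNorm_zero] at hw
    omega
  obtain ⟨hS, hJ⟩ := low_weight hk hA hx hx0 hw.le
  obtain ⟨j, hj⟩ := Finset.card_eq_one.1 hJ
  have hjmem (i : Fin 2) : x (.inr i) ≠ 0 ↔ i = j := by
    simpa using Finset.ext_iff.1 hj i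
  set S := finSupp x with hSdef
  have hc : x (.inr j) ≠ 0 := (hjmem j).2 rfl
  have hi (i : Fin 2) (h : i ≠ j) : x (.inr i) = 0 := not_not.1 fun h' => h ((hjmem i).1 h')
  -- Test against the nodal polynomial of `S`: it has degree `k - 1`, vanishes on `S`, and has top
  -- coefficients `1` and `-∑ S`.
  have hsum : A 0 j * ∑ a ∈ S, a = A 1 j := by
    have h := hx (Lagrange.nodal S id) (by
      rw [mem_degreeLT, Lagrange.degree_nodal]; exact_mod_cast (by omega : S.card < k))
    rw [pairing, sum_finSupp x _ subset_rfl, Finset.sum_eq_zero (fun a ha => by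
      rw [show eval a (Lagrange.nodal S id) = 0 from Lagrange.eval_nodal_at_node (v := id) ha,
        mul_zero]), zero_add, Finset.sum_eq_single j (fun i _ h => by rw [hi i h, zero_mul])
      (by simp)] at h
    have h1 := coeff_nodal_sub_one S (by omega)
    have h2 : (Lagrange.nodal S (id : F → F)).coeff S.card = 1 := by
      have h := (Lagrange.nodal_monic (s := S) (v := (id : F → F))).coeff_natDegree
      rwa [Lagrange.natDegree_nodal] at h
    rw [hS, Nat.sub_sub] at h1
    rw [hS] at h2
    rw [h1, h2] at h
    have := (mul_eq_zero.1 h).resolve_left hc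
    linear_combination -this
  refine ⟨j, S, x (.inr j), hc, hS, hsum, ?_⟩
  -- The difference from the model word vanishes at infinity and is supported on `S`, hence is zero.
  rw [← sub_eq_zero]
  have hmem := (fullDual k A).sub_mem hx (minWord_mem hk hS hsum (x (.inr j)))
  refine eq_zero_of_inl_eq_zero hk hA hmem (inl_eq_zero_of_pairing hmem (S := S) ?_ (by omega)
    (.inr fun i => ?_))
  · intro a ha
    by_contra haS
    rw [mem_finSupp] at ha
    refine ha ?_
    rw [hSdef, mem_finSupp, not_not] at haS
    simp only [Pi.sub_apply, haS, minWord, Sum.elim_inl, hSdef, mem_finSupp]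
    simp
  · by_cases h : i = j
    · subst h; simp [minWord]
    · simp [minWord, h, hi i h]

/-- A word of weight `k` determines its triple: `j` is its infinite support, `S` its finite support,
`c` its value at `j`. The factor `q - 1` counts the nonzero `c`. -/
lemma ncard_weight {k : ℕ} (hk : 2 ≤ k) {A : Matrix (Fin 2) (Fin 2) F} (hA : A.det ≠ 0) :
    Set.ncard {x | x ∈ fullDual k A ∧ hammingNorm x = k} = (Fintype.card F - 1) *
      ∑ j, (((Finset.univ : Finset F).powersetCard (k - 1)).filter
        fun S => A 0 j * ∑ a ∈ S, a = A 1 j).card := by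
  let P := (Finset.univ : Finset (Fin 2)).sigma fun j =>
    ((Finset.univ : Finset F).powersetCard (k - 1)).filter fun S => A 0 j * ∑ a ∈ S, a = A 1 j
  have hset : {x | x ∈ fullDual k A ∧ hammingNorm x = k} =
      (fun t : F × (_ : Fin 2) × Finset F => minWord A t.2.1 t.2.2 t.1) ''
        ((Finset.univ.erase (0 : F)) ×ˢ P : Finset _) := by
    ext x
    simp only [Set.mem_image, SetLike.mem_coe, Finset.mem_product, Finset.mem_erase,
      Finset.mem_univ, and_true, P, Finset.mem_sigma, true_and, Finset.mem_filter,
      Finset.mem_powersetCard_univ]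
    constructor
    · rintro ⟨hx, hw⟩
      obtain ⟨j, S, c, hc, hS, hsum, rfl⟩ := exists_eq_minWord hk hA hx hw
      exact ⟨⟨c, j, S⟩, ⟨hc, hS, hsum⟩, rfl⟩
    · rintro ⟨⟨c, j, S⟩, ⟨hc, hS, hsum⟩, rfl⟩
      refine ⟨minWord_mem hk hS hsum c, ?_⟩
      rw [hammingNorm_minWord (col_ne_zero hA hsum) S hc]
      simp only at hS
      omega
  rw [hset, Set.InjOn.ncard_image, Set.ncard_coe_finset, Finset.card_product,
    Finset.card_erase_of_mem (Finset.mem_univ _), Finset.card_univ, Finset.card_sigma]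
  rintro ⟨c, j, S⟩ h ⟨c', j', S'⟩ h' heq
  simp only [SetLike.mem_coe, Finset.mem_product, Finset.mem_erase,
      Finset.mem_univ, and_true, P, Finset.mem_sigma, true_and, Finset.mem_filter,
      Finset.mem_powersetCard_univ] at h h' heq
  obtain ⟨hc, hS, hsum⟩ := h
  obtain ⟨hc', hS', hsum'⟩ := h'
  have hj : j = j' := by
    have := infSupp_minWord A j S hc
    rw [heq, infSupp_minWord A j' S' hc'] at this
    exact (Finset.singleton_injective this).symm
  subst hj
  have hSS : S = S' := by
    have := finSupp_minWord (col_ne_zero hA hsum) S hc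
    rw [heq, finSupp_minWord (col_ne_zero hA hsum) S' hc'] at this
    exact this.symm
  subst hSS
  have := congrFun heq (.inr j)
  simp only [minWord, Sum.elim_inr, Pi.single_eq_same] at this
  rw [this]

lemma card_filter_eq_subsetSumCount {A : Matrix (Fin 2) (Fin 2) F} {j : Fin 2} (m : ℕ)
    (hj : A 0 j ≠ 0) :
    (((Finset.univ : Finset F).powersetCard m).filter
      fun S => A 0 j * ∑ a ∈ S, a = A 1 j).card = subsetSumCount F m (A 1 j / A 0 j) := by
  rw [subsetSumCount]
  congr 1
  ext S
  simp only [Finset.mem_filter, eq_div_iff hj, mul_comm]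

lemma card_filter_eq_zero {A : Matrix (Fin 2) (Fin 2) F} (hA : A.det ≠ 0) {j : Fin 2} (m : ℕ)
    (hj : A 0 j = 0) :
    (((Finset.univ : Finset F).powersetCard m).filter
      fun S => A 0 j * ∑ a ∈ S, a = A 1 j).card = 0 := by
  rw [Finset.card_eq_zero, Finset.filter_eq_empty_iff]
  exact fun S _ h => col_ne_zero hA h hj

end FullCode

end EGRLCode

/-! ### Dimensions, and transfer to the original coordinates -/

namespace EGRLCode

/-- The dot product identifies the dual code with the dual annihilator. -/
lemma finrank_dualCode {F ι : Type*} [Field F] [Fintype ι] (C : Submodule F (ι → F)) :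
    Module.finrank F C + Module.finrank F (dualCode C) = Fintype.card ι := by
  classical
  have h : (dualCode C).map (dotProductEquiv F ι).toLinearMap = C.dualAnnihilator := by
    ext φ
    rw [Submodule.mem_dualAnnihilator]
    constructor
    · rintro ⟨x, hx, rfl⟩ y hy
      exact hx y hy
    · intro hφ
      refine ⟨(dotProductEquiv F ι).symm φ, fun y hy => ?_, by simp⟩
      rw [← hφ y hy]
      exact LinearMap.congr_fun ((dotProductEquiv F ι).apply_symm_apply φ) y
  rw [← LinearEquiv.finrank_map_eq (dotProductEquiv F ι) (dualCode C), h,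
    Subspace.finrank_add_finrank_dualAnnihilator_eq, Module.finrank_fintype_fun_eq_card]

lemma finrank_EGRL {F : Type*} [Field F] {n k ℓ t : ℕ} (hk : k ≤ n) (α : Fin n ↪ F)
    (v : Fin n → Fˣ) (M : Matrix.GeneralLinearGroup (Fin ℓ) F) (b : Fˣ) :
    Module.finrank F (EGRL k ℓ t α v M b) = k := by
  have hinj : Function.Injective ((encode k ℓ t α v M b).domRestrict (degreeLT F k)) := by
    rw [← LinearMap.ker_eq_bot, LinearMap.ker_eq_bot']
    rintro ⟨f, hf⟩ h
    rw [Subtype.ext_iff]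
    refine eq_zero_of_degree_lt_of_eval_index_eq_zero (s := Finset.univ) α.injective.injOn ?_ ?_
    · rw [mem_degreeLT] at hf
      refine hf.trans_le ?_
      simpa using hk
    · intro i _
      have := congrFun h (.inl i)
      simpa [encode] using this
  rw [EGRL, ← LinearMap.range_domRestrict, LinearMap.finrank_range_of_inj hinj,
    LinearEquiv.finrank_eq (degreeLTEquiv F k)]
  simp

section Pull

variable {F : Type*} [Field F] {n : ℕ}

/-- The monomial change of coordinates that sends the last coordinate to the point `0` of `F`. -/
def pull (α : Fin n ↪ F) (b : Fˣ) (y : F ⊕ Fin 2 → F) : Fin n ⊕ Fin 2 ⊕ Fin 1 → F :=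
  Sum.elim (fun i => y (.inl (α i)))
    (Sum.elim (fun j => y (.inr j)) fun _ => (b⁻¹ : Fˣ) * y (.inl 0))

lemma sum_eq_sum_range_add [Fintype F] {α : Fin n ↪ F} (hα : Set.range α = {x : F | x ≠ 0})
    {R : Type*} [AddCommMonoid R] (g : F → R) : ∑ a, g a = ∑ i, g (α i) + g 0 := by
  classical
  have h : Finset.univ.erase (0 : F) = Finset.univ.map α := by
    ext a
    have := Set.ext_iff.1 hα a
    simp only [Set.mem_range] at this
    simp [this]
  rw [← Finset.sum_erase_add _ _ (Finset.mem_univ (0 : F)), h, Finset.sum_map]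

lemma pull_injective {α : Fin n ↪ F} (hα : Set.range α = {x : F | x ≠ 0}) (b : Fˣ) :
    Function.Injective (pull α b) := by
  intro y y' h
  ext (a | j)
  · by_cases ha : a = 0
    · subst ha
      simpa [pull] using congrFun h (.inr (.inr 0))
    · obtain ⟨i, rfl⟩ : a ∈ Set.range α := hα ▸ ha
      simpa [pull] using congrFun h (.inl i)
  · simpa [pull] using congrFun h (.inr (.inl j))

lemma pull_surjective [Fintype F] {α : Fin n ↪ F} (hα : Set.range α = {x : F | x ≠ 0}) (b : Fˣ) :
    Function.Surjective (pull α b) := by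
  classical
  refine ((Fintype.bijective_iff_injective_and_card _).2 ⟨pull_injective hα b, ?_⟩).2
  have := sum_eq_sum_range_add hα (fun _ => 1)
  simp only [Finset.sum_const, Finset.card_univ, Fintype.card_fin, smul_eq_mul, mul_one] at this
  simp [this]

lemma hammingNorm_pull [Fintype F] [DecidableEq F] {α : Fin n ↪ F}
    (hα : Set.range α = {x : F | x ≠ 0}) (b : Fˣ) (y : F ⊕ Fin 2 → F) :
    hammingNorm (pull α b y) = hammingNorm y := by
  simp only [hammingNorm, Finset.card_filter, Fintype.sum_sum_type]
  rw [sum_eq_sum_range_add hα]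
  simp [pull]
  ring

/-- The factor `b⁻¹` in `pull` cancels `b` in the last coordinate, leaving the term `y (.inl 0) *
f(0)`. -/
lemma pull_mem_iff [Fintype F] {α : Fin n ↪ F} (hα : Set.range α = {x : F | x ≠ 0}) {k : ℕ}
    (hk : 2 ≤ k) (M : Matrix.GeneralLinearGroup (Fin 2) F) (b : Fˣ) (y : F ⊕ Fin 2 → F) :
    pull α b y ∈ dualCode (EGRL k 2 0 α (fun _ => 1) M b) ↔
      y ∈ fullDual k (M : Matrix (Fin 2) (Fin 2) F) := by
  have key (f : F[X]) : ∑ i, pull α b y i * encode k 2 0 α (fun _ => 1) M b f i =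
      pairing k (M : Matrix (Fin 2) (Fin 2) F) y f := by
    rw [pairing, sum_eq_sum_range_add hα]
    simp only [Fintype.sum_sum_type, pull, encode, LinearMap.coe_mk, AddHom.coe_mk, Sum.elim_inl,
      Sum.elim_inr, Units.val_one, one_mul, Matrix.vecMul, dotProduct, Fin.sum_univ_two,
      Fin.val_zero, Fin.val_one, add_zero, show k - 2 + 1 = k - 1 by omega,
      Finset.univ_unique, Finset.sum_singleton, coeff_zero_eq_eval_zero]
    have hb : ((b⁻¹ : Fˣ) : F) * b = 1 := b.inv_mul
    linear_combination y (.inl 0) * eval 0 f * hb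
  constructor
  · intro h f hf
    rw [← key]
    exact h _ ⟨f, hf, rfl⟩
  · rintro h _ ⟨f, hf, rfl⟩
    rw [key]
    exact h f hf

lemma weightCount_eq [Fintype F] [DecidableEq F] {α : Fin n ↪ F}
    (hα : Set.range α = {x : F | x ≠ 0}) {k : ℕ}
    (hk : 2 ≤ k) (M : Matrix.GeneralLinearGroup (Fin 2) F) (b : Fˣ) (w : ℕ) :
    weightCount (dualCode (EGRL k 2 0 α (fun _ => 1) M b)) w =
      Set.ncard {x | x ∈ fullDual k (M : Matrix (Fin 2) (Fin 2) F) ∧ hammingNorm x = w} := by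
  rw [weightCount, ← Set.ncard_image_of_injective _ (pull_injective hα b)]
  congr 1
  ext x
  obtain ⟨y, rfl⟩ := pull_surjective hα b x
  simp only [Set.mem_ofPred_eq, (pull_injective hα b).mem_set_image, pull_mem_iff hα hk,
    hammingNorm_pull hα]

end Pull

/-- The parameters of the dual code. -/
theorem hasParams_dualCode {F : Type*} [Field F] [Fintype F] [DecidableEq F] {p q : ℕ} [CharP F p]
    (hq : Fintype.card F = q) {α : Fin (q - 1) ↪ F} (hα : Set.range α = {x : F | x ≠ 0})
    (M : Matrix.GeneralLinearGroup (Fin 2) F) (b : Fˣ) {k : ℕ}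
    (hk : (p = 2 ∧ 5 ≤ k ∧ k ≤ q - 2) ∨ (p ≠ 2 ∧ 4 ≤ k ∧ k ≤ q - 1)) :
    HasParams (dualCode (EGRL k 2 0 α (fun _ => 1) M b)) (q + 2) (q + 2 - k) k := by
  have hlen : Fintype.card (Fin (q - 1) ⊕ Fin 2 ⊕ Fin 1) = q + 2 := by
    simp only [Fintype.card_sum, Fintype.card_fin]
    omega
  have hdet : (M : Matrix (Fin 2) (Fin 2) F).det ≠ 0 :=
    (Matrix.isUnit_iff_isUnit_det _).1 M.isUnit |>.ne_zero
  refine ⟨hlen, ?_, ?_, ?_⟩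
  · have h1 := finrank_dualCode (EGRL k 2 0 α (fun _ => 1) M b)
    rw [finrank_EGRL (by omega), hlen] at h1
    omega
  · obtain ⟨j, hj⟩ : ∃ j, (M : Matrix (Fin 2) (Fin 2) F) 0 j ≠ 0 := by
      by_contra! h
      exact hdet (by rw [Matrix.det_fin_two, h 0, h 1]; ring)
    -- With `m = k - 1`, the upper bounds on `k` amount to `m + 2 ≤ q`, and to `m + 3 ≤ q` in
    -- characteristic two.
    obtain ⟨S, hS, hsum⟩ := exists_finset_card_sum_eq (F := F) (p := p) (m := k - 1) (by omega)
      (by omega) (by omega) (by omega)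
      ((M : Matrix (Fin 2) (Fin 2) F) 1 j / (M : Matrix (Fin 2) (Fin 2) F) 0 j)
    rw [eq_div_iff hj, mul_comm] at hsum
    have hw := hammingNorm_minWord hj S (one_ne_zero (α := F))
    have hmem := minWord_mem (by omega) hS hsum 1
    refine ⟨pull α b (minWord _ j S 1), (pull_mem_iff hα (by omega) M b _).2 hmem, ?_, ?_⟩
    · rw [← hammingNorm_ne_zero_iff, hammingNorm_pull hα, hw]
      omega
    · rw [hammingNorm_pull hα, hw]
      omega
  · rintro w ⟨x, hx, hx0, rfl⟩
    obtain ⟨y, rfl⟩ := pull_surjective hα b x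
    rw [pull_mem_iff hα (by omega)] at hx
    rw [← hammingNorm_ne_zero_iff] at hx0
    rw [hammingNorm_pull hα] at hx0 ⊢
    exact le_hammingNorm (by omega) hdet hx (hammingNorm_ne_zero_iff.1 hx0)

end EGRLCode

/-! ### The weight count by shape of the matrix -/

theorem theorem5p4 {F : Type*} [Field F] [Fintype F] [DecidableEq F] (p : ℕ) [CharP F p]
    (q : ℕ) (hq : Fintype.card F = q)
    (α : Fin (q - 1) ↪ F) (hα : Set.range α = {x : F | x ≠ 0})
    (M : Matrix.GeneralLinearGroup (Fin 2) F) (a₁₁ a₁₂ a₂₁ a₂₂ : F)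
    (hM : (M : Matrix (Fin 2) (Fin 2) F) = !![a₁₁, a₁₂; a₂₁, a₂₂]) (b : Fˣ) (k : ℕ)
    (hk : (p = 2 ∧ 5 ≤ k ∧ k ≤ q - 2) ∨ (p ≠ 2 ∧ 4 ≤ k ∧ k ≤ q - 1)) :
    let C := EGRLCode.dualCode (EGRLCode.EGRL k 2 0 α (fun _ => 1) M b)
    EGRLCode.IsAMDS C ∧
    EGRLCode.HasParams C (q + 2) (q + 2 - k) k ∧
    (a₁₁ * a₂₁ * a₁₂ * a₂₂ ≠ 0 →
      (EGRLCode.weightCount C k : ℚ) =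
        2 * ((q : ℚ) - 1) / q * (q.choose (k - 1) : ℚ) +
          (-1) ^ (k - 1) * (2 * ((q : ℚ) - 1) / q) * (EGRLCode.theta q p k : ℚ)) ∧
    ((a₁₁ * a₁₂ * a₂₁ ≠ 0 ∧ a₂₂ = 0) ∨ (a₁₁ * a₁₂ * a₂₂ ≠ 0 ∧ a₂₁ = 0) →
      (EGRLCode.weightCount C k : ℚ) =
        2 * ((q : ℚ) - 1) / q * (q.choose (k - 1) : ℚ) +
          (-1) ^ (k - 2) * (((q : ℚ) - 1) * ((q : ℚ) - 2) / q) * (EGRLCode.theta q p k : ℚ)) ∧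
    ((a₁₁ * a₂₁ * a₂₂ ≠ 0 ∧ a₁₂ = 0) ∨ (a₁₂ * a₂₁ * a₂₂ ≠ 0 ∧ a₁₁ = 0) →
      (EGRLCode.weightCount C k : ℚ) =
        ((q : ℚ) - 1) / q * (q.choose (k - 1) : ℚ) +
          (-1) ^ (k - 1) * (((q : ℚ) - 1) / q) * (EGRLCode.theta q p k : ℚ)) ∧
    ((a₁₁ * a₂₂ ≠ 0 ∧ a₁₂ = 0 ∧ a₂₁ = 0) ∨ (a₁₂ * a₂₁ ≠ 0 ∧ a₁₁ = 0 ∧ a₂₂ = 0) →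
      (EGRLCode.weightCount C k : ℚ) =
        ((q : ℚ) - 1) / q * (q.choose (k - 1) : ℚ) +
          (-1) ^ (k - 2) * (((q : ℚ) - 1) ^ 2 / q) * (EGRLCode.theta q p k : ℚ)) := by
  intro C
  have hparams := EGRLCode.hasParams_dualCode hq hα M b hk
  have hp : p.Prime := CharP.char_is_prime F p
  have hdet : (M : Matrix (Fin 2) (Fin 2) F).det ≠ 0 :=
    (Matrix.isUnit_iff_isUnit_det _).1 M.isUnit |>.ne_zero
  have hcount := (EGRLCode.weightCount_eq hα (show 2 ≤ k by omega) M b k).trans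
    (EGRLCode.ncard_weight (by omega) hdet)
  rw [Fin.sum_univ_two] at hcount
  have h00 : (M : Matrix (Fin 2) (Fin 2) F) 0 0 = a₁₁ := by rw [hM]; rfl
  have h01 : (M : Matrix (Fin 2) (Fin 2) F) 0 1 = a₁₂ := by rw [hM]; rfl
  have h10 : (M : Matrix (Fin 2) (Fin 2) F) 1 0 = a₂₁ := by rw [hM]; rfl
  have h11 : (M : Matrix (Fin 2) (Fin 2) F) 1 1 = a₂₂ := by rw [hM]; rfl
  have hcol (j : Fin 2) := EGRLCode.card_filter_eq_subsetSumCount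
    (A := (M : Matrix (Fin 2) (Fin 2) F)) (j := j) (k - 1)
  have hcol0 (j : Fin 2) := EGRLCode.card_filter_eq_zero hdet (j := j) (k - 1)
  have hnz {c : F} (hc : c ≠ 0) := EGRLCode.subsetSumCount_of_ne_zero (F := F) hp
    (m := k - 1) (by omega) (by omega) hc
  have hz := EGRLCode.subsetSumCount_zero (F := F) hp (m := k - 1) (by omega) (by omega)
  rw [Nat.sub_add_cancel (by omega), hq] at hz
  simp only [Nat.sub_add_cancel (show 1 ≤ k by omega), hq] at hnz
  have hq0 : (q : ℚ) ≠ 0 := by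
    rw [← hq]; exact_mod_cast Fintype.card_ne_zero
  have hcount' : (EGRLCode.weightCount C k : ℚ) = ((q : ℚ) - 1) * (_ + _) :=
    (congrArg (Nat.cast (R := ℚ)) hcount).trans (by
      rw [hq, Nat.cast_mul, Nat.cast_sub (by omega), Nat.cast_add, Nat.cast_one])
  have hsign : (-1 : ℚ) ^ (k - 1) = -(-1) ^ (k - 2) := by
    rw [show k - 1 = k - 2 + 1 by omega, pow_succ]; ring
  have hc0 := hcol 0
  have hc1 := hcol 1
  have hd0 := hcol0 0
  have hd1 := hcol0 1
  rw [h00, h10] at hc0 hd0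
  rw [h01, h11] at hc1 hd1
  rw [h00, h01, h10, h11] at hcount'
  -- Each column contributes the count for a nonzero sum if both entries are nonzero, for sum zero
  -- if only the bottom entry vanishes, and nothing if the top one does. The four cases add up two
  -- such contributions.
  refine ⟨⟨_, _, _, hparams, by omega⟩, hparams, fun h => ?_, fun h => ?_, fun h => ?_, fun h => ?_⟩
  · simp only [ne_eq, mul_eq_zero, not_or] at h
    obtain ⟨⟨⟨h1, h2⟩, h3⟩, h4⟩ := h
    rw [hcount', hc0 h1, hc1 h3, hnz (div_ne_zero h2 h1), hnz (div_ne_zero h4 h3)]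
    field_simp
    ring
  · simp only [ne_eq, mul_eq_zero, not_or] at h
    obtain ⟨⟨⟨h1, h2⟩, h3⟩, rfl⟩ | ⟨⟨⟨h1, h2⟩, h3⟩, rfl⟩ := h
    · rw [hcount', hc0 h1, hc1 h2, hnz (div_ne_zero h3 h1), zero_div, hz, hsign]
      field_simp
      ring
    · rw [hcount', hc0 h1, hc1 h2, hnz (div_ne_zero h3 h2), zero_div, hz, hsign]
      field_simp
      ring
  · simp only [ne_eq, mul_eq_zero, not_or] at h
    obtain ⟨⟨⟨h1, h2⟩, h3⟩, h4⟩ | ⟨⟨⟨h1, h2⟩, h3⟩, h4⟩ := h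
    · rw [hcount', hc0 h1, hd1 h4, hnz (div_ne_zero h2 h1)]
      field_simp
      ring
    · rw [hcount', hd0 h4, hc1 h1, hnz (div_ne_zero h3 h1)]
      field_simp
      ring
  · simp only [ne_eq, mul_eq_zero, not_or] at h
    obtain ⟨⟨h1, h2⟩, h3, rfl⟩ | ⟨⟨h1, h2⟩, h3, rfl⟩ := h
    · rw [hcount', hc0 h1, hd1 h3, zero_div, hz, hsign]
      field_simp
      ring
    · rw [hcount', hd0 h3, hc1 h1, zero_div, hz, hsign]
      field_simp
      ring
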